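/- Let $k\ge 2$ and $n\ge 1$ be integers, let $\bar{\mathcal P}=(\bar p_{i_1\dots i_k})$ be a columnwise-substochastic real tensor of order $k$ and dimension $n$, i.e. $\bar p_{i_1\dots i_k}\ge 0$ for all indices and $\sum_{i=1}^n \bar p_{i i_2\dots i_k}\le 1$ for all $i_2,\dots,i_k\in\{1,\dots,n\}$. Let $\mathbf v\in\mathbb R^n$ be a stochastic vector, i.e. $\mathbf v\ge 0$ entrywise and $\sum_{i=1}^n v_i=1$, and let $\alpha\in[0,1)$. Let $I$ be the $n\times n$ identity matrix, let $\mathbf e=(1,\dots,1)^T\in\mathbb R^n$, and let $I\circ\mathbf e^{\circ(k-2)}$ be the tensor outer product of $I$ with $k-2$ copies of $\mathbf e$, i.e. the tensor of order $k$ whose $(i_1,\dots,i_k)$ entry is $1$ if $i_1=i_2$ and $0$ otherwise. For a tensor $\mathcal T$ of order $k$ and dimension $n$ and $\mathbf y\in\mathbb R^n$, let $\mathcal T\mathbf y^{k-1}\in\mathbb R^n$ be the vector with entries $(\mathcal T\mathbf y^{k-1})_{i}=\sum_{i_2,\dots,i_k=1}^n t_{i i_2\dots i_k}\,y_{i_2}\cdots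 y_{i_k}$. Then the multi-linear pseudo-PageRank (MLPPR) system $$\left(I\circ\mathbf e^{\circ(k-2)}-\alpha\bar{\mathcal P}\right)\mathbf y^{k-1}=\mathbf v$$ has at least one nonzero solution $\mathbf y\in\mathbb R^n$ that is entrywise nonnegative. -/

import Mathlib

namespace MLPPR

/-- Real tensors of order `k` and dimension `n`: the entry with indices `i₁, …, i_k` is
`T ![i₁, …, i_k]`. Algebraic operations and the order are entrywise. -/
abbrev Tensor (k n : ℕ) : Type := (Fin k → Fin n) → ℝ

/-- A vector, viewed as a tensor of order `1`. -/
def ofVec {n : ℕ} (x : Fin n → ℝ) : Tensor 1 n := fun i => x (i 0)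

/-- A square matrix, viewed as a tensor of order `2`. -/
def ofMatrix {n : ℕ} (A : Matrix (Fin n) (Fin n) ℝ) : Tensor 2 n := fun i => A (i 0) (i 1)

/-- The tensor outer product `X ∘ Y`. -/
def outer {k l n : ℕ} (X : Tensor k n) (Y : Tensor l n) : Tensor (k + l) n :=
  fun i => X (fun a => i (Fin.castAdd l a)) * Y (fun b => i (Fin.natAdd k b))

/-- The outer product `x ∘ ⋯ ∘ x` of `m` copies of a vector (the scalar `1` for `m = 0`). -/
def outerPow {n : ℕ} (x : Fin n → ℝ) : (m : ℕ) → Tensor m n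
  | 0 => fun _ => 1
  | m + 1 => outer (outerPow x m) (ofVec x)

/-- Transport of a tensor along an equality of orders; the entries do not change. -/
def castOrder {k l n : ℕ} (h : k = l) (X : Tensor k n) : Tensor l n :=
  fun i => X (fun a => i (Fin.cast h a))

/-- The `s`-mode product of a tensor with a vector: the sum over the index in position `s`
(counted from `0`) against `x`. -/
def modeProd {k n : ℕ} (T : Tensor (k + 1) n) (s : Fin (k + 1)) (x : Fin n → ℝ) : Tensor k n :=
  fun i => ∑ j, T (s.insertNth j i) * x j

/-- For a tensor `T` of order `k = m + 1`, the vector `T x^{k-1}`: all modes except the first one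
are multiplied by `x`. -/
def applyVec {n : ℕ} : {m : ℕ} → Tensor (m + 1) n → (Fin n → ℝ) → (Fin n → ℝ)
  | 0, T, _ => fun i => T ![i]
  | _ + 1, T, x => applyVec (modeProd T (Fin.last _) x) x

/-- The mode-1 unfolding of a tensor of order `m + 1`: its columns, indexed by the tuples of the
last `m` indices, are the mode-1 fibers. -/
def unfold {m n : ℕ} (T : Tensor (m + 1) n) : Matrix (Fin n) (Fin m → Fin n) ℝ :=
  Matrix.of fun i j => T (Fin.cons i j)

/-- Columnwise-substochastic: nonnegative, and all column sums of the unfolding are at most `1`. -/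
def IsColumnwiseSubstochastic {m n : ℕ} (T : Tensor (m + 1) n) : Prop :=
  0 ≤ T ∧ Matrix.vecMul 1 (unfold T) ≤ 1

/-- The Laplacian tensor `I ∘ e^{∘(k-2)} - α P` of order `k = m + 2`, where `e` is the all-one
vector. -/
def laplacian {m n : ℕ} (α : ℝ) (P : Tensor (m + 2) n) : Tensor (m + 2) n :=
  castOrder (Nat.add_comm 2 m) (outer (ofMatrix 1) (outerPow (1 : Fin n → ℝ) m)) - α • P

end MLPPR

/-! On the simplex, `x ↦ α P x^{k-1} + σ(x) v` with `σ(x) = 1 - α ∑ (P x^{k-1})_i` is a continuous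
self-map: substochasticity and `α < 1` make `σ` positive, and the `v` term restores total mass `1`.
At a fixed point `x - α P x^{k-1} = σ v`. As `∑ x = 1`, the left side is the Laplacian applied to
`x` (`applyVec_laplacian`). It is homogeneous of degree `k - 1`, so scaling `x` by the `(k-1)`-th
root of `1/σ` gives a solution.

The fixed point comes from Brouwer's theorem, proved combinatorially. A parity count of dominant
sets (`exists_dominant_image_eq_univ`) gives a form of Scarf's lemma (`exists_colourful`). Applied
to grid points ranked by their coordinates, it yields approximate fixed points
(`exists_approx_fixedPoint`), and compactness does the rest. -/

namespace MLPPR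

/-! ### Dominant sets and their extensions by one point -/

/-- `S` is dominant for the rankings `ρ` if no point lies strictly above the minimum of `S` in
every ranking. -/
def Dominant {X I : Type*} (ρ : I → X → ℕ) (S : Finset X) : Prop :=
  ∀ t, ∃ i, ∀ s ∈ S, ρ i t ≤ ρ i s

theorem Dominant.mono {X I : Type*} {ρ : I → X → ℕ} {S R : Finset X} (hR : Dominant ρ R)
    (h : S ⊆ R) : Dominant ρ S := fun t => by
  obtain ⟨i, hi⟩ := hR t
  exact ⟨i, fun s hs => hi s (h hs)⟩

/-- A nonempty finset has a minimizer for every ranking; in a dominant set every point is one. -/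
theorem Dominant.exists_argmin {X I : Type*} {ρ : I → X → ℕ}
    (hρ : ∀ i, Function.Injective (ρ i)) {S : Finset X} (hS : Dominant ρ S) (hne : S.Nonempty) :
    ∃ μ : I → X, (∀ i, μ i ∈ S) ∧ (∀ i, ∀ s ∈ S, ρ i (μ i) ≤ ρ i s) ∧
      ∀ s ∈ S, ∃ i, μ i = s := by
  choose μ hμ hμ' using fun i => S.exists_min_image (ρ i) hne
  refine ⟨μ, hμ, hμ', fun s hs => ?_⟩
  obtain ⟨i, hi⟩ := hS s
  exact ⟨i, hρ i (le_antisymm (hμ' i s hs) (hi _ (hμ i)))⟩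

/-- In a dominant set with one element less than there are rankings, exactly two rankings share
their minimizer. -/
theorem exists_common_of_surjective {X I : Type*} [Fintype I] [DecidableEq I] [DecidableEq X]
    {S : Finset X} (μ : I → X) (hμ : ∀ i, μ i ∈ S) (hsurj : ∀ s ∈ S, ∃ i, μ i = s)
    (hcard : S.card + 1 = Fintype.card I) :
    ∃ a b, a ≠ b ∧ μ a = μ b ∧ (∀ s ∈ S, ∃ i, i ≠ a ∧ μ i = s) ∧
      (∀ s ∈ S, ∃ i, i ≠ b ∧ μ i = s) ∧
      ∀ i j, i ≠ j → μ i = μ j → (i = a ∧ j = b) ∨ (i = b ∧ j = a) := by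
  obtain ⟨a, -, b, -, hab, hμab⟩ := Finset.exists_ne_map_eq_of_card_lt_of_maps_to
    (s := Finset.univ) (t := S) (f := μ) (by rw [Finset.card_univ]; omega) (fun i _ => hμ i)
  have hA : ∀ a b, a ≠ b → μ a = μ b → ∀ s ∈ S, ∃ i, i ≠ a ∧ μ i = s := by
    intro a b hab h s hs
    obtain ⟨i, rfl⟩ := hsurj s hs
    by_cases hi : i = a
    · subst hi; exact ⟨b, hab.symm, h.symm⟩
    · exact ⟨i, hi, rfl⟩
  have hinj : Set.InjOn μ (Finset.univ.erase a : Finset I) := by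
    apply Finset.injOn_of_card_image_eq
    rw [Finset.card_erase_of_mem (Finset.mem_univ _), Finset.card_univ]
    have : (Finset.univ.erase a).image μ = S := by
      ext s
      simp only [Finset.mem_image, Finset.mem_erase, Finset.mem_univ, and_true]
      exact ⟨by rintro ⟨i, -, rfl⟩; exact hμ i, hA a b hab hμab s⟩
    rw [this]; omega
  have hinj' : ∀ i j, i ≠ a → j ≠ a → μ i = μ j → i = j := fun i j hi hj h =>
    hinj (by simpa using hi) (by simpa using hj) h
  refine ⟨a, b, hab, hμab, hA a b hab hμab, hA b a hab.symm hμab.symm, fun i j hij h => ?_⟩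
  by_cases hi : i = a
  · subst hi
    exact Or.inl ⟨rfl, hinj' j b (Ne.symm hij) hab.symm (h.symm.trans hμab)⟩
  · by_cases hj : j = a
    · subst hj
      exact Or.inr ⟨hinj' i b hi hab.symm (h.trans hμab), rfl⟩
    · exact absurd (hinj' i j hi hj h) hij

/-- `x` extends `S` at `a`: it is the `a`-highest among the points above `S` in all rankings other
than `a`; here `μ` gives the minimizers of `S`. -/
def IsExtension {X I : Type*} (ρ : I → X → ℕ) (μ : I → X) (a : I) (x : X) : Prop :=
  (∀ j, j ≠ a → ρ j (μ j) < ρ j x) ∧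
    ∀ t, (∀ j, j ≠ a → ρ j (μ j) < ρ j t) → ρ a t ≤ ρ a x

theorem IsExtension.unique {X I : Type*} {ρ : I → X → ℕ} (hρ : ∀ i, Function.Injective (ρ i))
    {μ : I → X} {a : I} {x y : X} (hx : IsExtension ρ μ a x) (hy : IsExtension ρ μ a y) : x = y :=
  hρ a (le_antisymm (hy.2 x hx.1) (hx.2 y hy.1))

theorem exists_isExtension {X I : Type*} [Finite X] {ρ : I → X → ℕ} {μ : I → X} {a : I} {t : X}
    (ht : ∀ j, j ≠ a → ρ j (μ j) < ρ j t) : ∃ x, IsExtension ρ μ a x := by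
  obtain ⟨x, hx, hx'⟩ := Set.exists_max_image {t | ∀ j, j ≠ a → ρ j (μ j) < ρ j t} (ρ a)
    (Set.toFinite _) ⟨t, ht⟩
  exact ⟨x, hx, hx'⟩

section Extension

variable {X I : Type*} {ρ : I → X → ℕ}
  {S : Finset X} {μ : I → X}

/-- Dominance of `S` puts `x` weakly below all of `S` in some ranking. This can only be `a`, since
`x` beats the minimizer in every other one. -/
theorem IsExtension.lt {a : I} {x : X} (hρ : ∀ i, Function.Injective (ρ i)) (hS : Dominant ρ S)
    (hμ : ∀ i, μ i ∈ S) (hA : ∀ s ∈ S, ∃ i, i ≠ a ∧ μ i = s)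
    (hx : IsExtension ρ μ a x) : x ∉ S ∧ ρ a x < ρ a (μ a) := by
  have hxS : x ∉ S := fun h => by
    obtain ⟨i, hi, rfl⟩ := hA x h
    exact lt_irrefl _ (hx.1 i hi)
  refine ⟨hxS, ?_⟩
  obtain ⟨i, hi⟩ := hS x
  have hia : i = a := by
    by_contra hia
    exact absurd (hi _ (hμ i)) (not_le.mpr (hx.1 i hia))
  subst hia
  exact lt_of_le_of_ne (hi _ (hμ i)) fun h => hxS (hρ i h ▸ hμ i)

theorem IsExtension.dominant [DecidableEq X] {a : I} {x : X} (hρ : ∀ i, Function.Injective (ρ i))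
    (hS : Dominant ρ S) (hμ : ∀ i, μ i ∈ S) (hμ' : ∀ i, ∀ s ∈ S, ρ i (μ i) ≤ ρ i s)
    (hA : ∀ s ∈ S, ∃ i, i ≠ a ∧ μ i = s) (hx : IsExtension ρ μ a x) :
    Dominant ρ (insert x S) := by
  have hlt := (hx.lt hρ hS hμ hA).2
  intro t
  by_cases h : ∀ j, j ≠ a → ρ j (μ j) < ρ j t
  · refine ⟨a, fun s hs => ?_⟩
    rcases Finset.mem_insert.1 hs with rfl | hs
    · exact hx.2 t h
    · exact (hx.2 t h).trans (hlt.le.trans (hμ' a s hs))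
  · push Not at h
    obtain ⟨j, hj, hjt⟩ := h
    refine ⟨j, fun s hs => ?_⟩
    rcases Finset.mem_insert.1 hs with rfl | hs
    · exact hjt.trans (hx.1 j hj).le
    · exact hjt.trans (hμ' j s hs)

/-- The new point is lowest in some ranking `p`. By dominance every old point remains lowest in some
ranking, so the minimizer displaced in `p` must be shared with another ranking. Hence `p` is `a` or
`b`. -/
theorem Dominant.isExtension [DecidableEq X] {a b : I} {x : X}
    (hρ : ∀ i, Function.Injective (ρ i)) (hμ : ∀ i, μ i ∈ S)
    (hμ' : ∀ i, ∀ s ∈ S, ρ i (μ i) ≤ ρ i s)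
    (huniq : ∀ i j, i ≠ j → μ i = μ j → (i = a ∧ j = b) ∨ (i = b ∧ j = a))
    (hxS : x ∉ S) (hx : Dominant ρ (insert x S)) :
    IsExtension ρ μ a x ∨ IsExtension ρ μ b x := by
  have hxm := Finset.mem_insert_self x S
  have hSm : ∀ s ∈ S, s ∈ insert x S := fun s hs => Finset.mem_insert_of_mem hs
  have key : ∀ i, ∃ j, μ j = μ i ∧ ρ j (μ j) < ρ j x := by
    intro i
    obtain ⟨j, hj⟩ := hx (μ i)
    have h1 : μ j = μ i := hρ j (le_antisymm (hμ' j _ (hμ i)) (hj _ (hSm _ (hμ j))))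
    refine ⟨j, h1, lt_of_le_of_ne (h1 ▸ hj x hxm) fun h => hxS (hρ j h ▸ hμ j)⟩
  obtain ⟨p, hp⟩ := hx x
  have hpp : ρ p x ≤ ρ p (μ p) := hp _ (hSm _ (hμ p))
  have hext : IsExtension ρ μ p x := by
    obtain ⟨q, hq, hqx⟩ := key p
    have hqp : q ≠ p := by rintro rfl; exact absurd hpp (not_le.mpr hqx)
    refine ⟨fun i hi => ?_, fun t ht => ?_⟩
    · obtain ⟨j, hj, hjx⟩ := key i
      have hjp : j ≠ p := by rintro rfl; exact absurd hpp (not_le.mpr hjx)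
      by_cases hji : j = i
      · exact hji ▸ hjx
      · have h1 := huniq _ _ hji hj
        have h2 := huniq _ _ hqp hq
        grind
    · obtain ⟨i, hi⟩ := hx t
      by_cases hip : i = p
      · subst hip; exact hi x hxm
      · exact absurd (hi _ (hSm _ (hμ i))) (not_le.mpr (ht i hip))
  obtain ⟨q, hq, hqx⟩ := key p
  have hqp : q ≠ p := by rintro rfl; exact absurd hpp (not_le.mpr hqx)
  rcases huniq _ _ hqp hq with ⟨-, rfl⟩ | ⟨-, rfl⟩
  · exact Or.inr hext
  · exact Or.inl hext

end Extension

/-! ### Parity argument with one slack point `Sum.inr i` per ranking -/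

section Slack

variable {T I : Type*} [Fintype I] [DecidableEq I]
  {ρ : I → T ⊕ I → ℕ}

/-- The dominant sets of full size containing `S` are the extensions of `S` at the two rankings
that share their minimizer. -/
theorem Dominant.superset_iff {X : Type*} [DecidableEq X] {ρ : I → X → ℕ}
    (hρ : ∀ i, Function.Injective (ρ i)) {S : Finset X} (hS : Dominant ρ S) (hne : S.Nonempty)
    (hcard : S.card + 1 = Fintype.card I) :
    ∃ (μ : I → X) (a b : I), a ≠ b ∧ μ a = μ b ∧ (∀ i, μ i ∈ S) ∧
      (∀ i, ∀ s ∈ S, ρ i (μ i) ≤ ρ i s) ∧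
      (∀ x, IsExtension ρ μ a x → x ∉ S) ∧ (∀ x, IsExtension ρ μ b x → x ∉ S) ∧
      (∀ x, IsExtension ρ μ a x → ¬ IsExtension ρ μ b x) ∧
      ∀ R, (Dominant ρ R ∧ R.card = Fintype.card I) ∧ S ⊆ R ↔
        ∃ x, (IsExtension ρ μ a x ∨ IsExtension ρ μ b x) ∧ R = insert x S := by
  obtain ⟨μ, hμ, hμ', hsurj⟩ := hS.exists_argmin hρ hne
  obtain ⟨a, b, hab, hμab, hA, hB, huniq⟩ := exists_common_of_surjective μ hμ hsurj hcard
  have ha : ∀ x, IsExtension ρ μ a x → x ∉ S := fun x h => (h.lt hρ hS hμ hA).1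
  have hb : ∀ x, IsExtension ρ μ b x → x ∉ S := fun x h => (h.lt hρ hS hμ hB).1
  refine ⟨μ, a, b, hab, hμab, hμ, hμ', ha, hb, fun x h h' => ?_, fun R => ⟨?_, ?_⟩⟩
  · exact absurd (h.lt hρ hS hμ hA).2 (h'.1 a hab).le.not_gt
  · rintro ⟨⟨hR, hRc⟩, hSR⟩
    obtain ⟨x, hx, rfl⟩ := Finset.exists_eq_insert_iff.2 ⟨hSR, hcard.trans hRc.symm⟩
    exact ⟨x, hR.isExtension hρ hμ hμ' huniq hx, rfl⟩
  · rintro ⟨x, hx, rfl⟩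
    refine ⟨⟨?_, ?_⟩, Finset.subset_insert _ _⟩
    · rcases hx with hx | hx
      · exact hx.dominant hρ hS hμ hμ' hA
      · exact hx.dominant hρ hS hμ hμ' hB
    · rw [Finset.card_insert_of_notMem (hx.elim (ha x) (hb x)), hcard]

open Classical in
theorem Dominant.card_superset_eq_two [Fintype T] (hρ : ∀ i, Function.Injective (ρ i))
    (hslack' : ∀ i j t, j ≠ i → ρ i (Sum.inl t) < ρ i (Sum.inr j))
    {S : Finset (T ⊕ I)} (hS : Dominant ρ S) (hcard : S.card + 1 = Fintype.card I)
    {t : T} (ht : Sum.inl t ∈ S) :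
    (Finset.univ.filter fun R : Finset (T ⊕ I) =>
      (Dominant ρ R ∧ R.card = Fintype.card I) ∧ S ⊆ R).card = 2 := by
  obtain ⟨μ, a, b, hab, hμab, hμ, hμ', ha, hb, hdis, hiff⟩ := hS.superset_iff hρ ⟨_, ht⟩ hcard
  -- The slack of `a` lies above `inl t`, hence above the minimizer, in every other ranking, so both
  -- extensions exist.
  have hex : ∀ a, ∃ x, IsExtension ρ μ a x := fun a =>
    exists_isExtension (t := Sum.inr a) fun j hj =>
      (hμ' j _ ht).trans_lt (hslack' j a t hj.symm)
  obtain ⟨x, hx⟩ := hex a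
  obtain ⟨y, hy⟩ := hex b
  rw [Finset.card_eq_two]
  refine ⟨insert x S, insert y S, fun h => ?_, ?_⟩
  · have hxy : x ∈ insert y S := h ▸ Finset.mem_insert_self x S
    rcases Finset.mem_insert.1 hxy with rfl | h'
    · exact hdis _ hx hy
    · exact ha x hx h'
  · ext R
    simp only [Finset.mem_filter, Finset.mem_univ, true_and, hiff, Finset.mem_insert,
      Finset.mem_singleton]
    constructor
    · rintro ⟨z, hz | hz, rfl⟩
      · exact Or.inl (by rw [hz.unique hρ hx])
      · exact Or.inr (by rw [hz.unique hρ hy])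
    · rintro (rfl | rfl)
      · exact ⟨x, Or.inl hx, rfl⟩
      · exact ⟨y, Or.inr hy, rfl⟩

theorem dominant_slacks [DecidableEq (T ⊕ I)]
    (hslack : ∀ i x, x ≠ Sum.inr i → ρ i (Sum.inr i) < ρ i x)
    (hslack' : ∀ i j t, j ≠ i → ρ i (Sum.inl t) < ρ i (Sum.inr j)) (i₀ : I) :
    Dominant ρ ((Finset.univ.erase i₀).image Sum.inr) := by
  rintro (t | i)
  · refine ⟨i₀, fun s hs => ?_⟩
    obtain ⟨j, hj, rfl⟩ := Finset.mem_image.1 hs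
    exact (hslack' i₀ j t (Finset.ne_of_mem_erase hj)).le
  · refine ⟨i, fun s hs => ?_⟩
    by_cases h : s = Sum.inr i
    · rw [h]
    · exact (hslack i s h).le

theorem card_slacks [DecidableEq (T ⊕ I)] (i₀ : I) :
    ((Finset.univ.erase i₀).image (Sum.inr : I → T ⊕ I)).card + 1 = Fintype.card I := by
  rw [Finset.card_image_of_injective _ Sum.inr_injective,
    Finset.card_erase_add_one (Finset.mem_univ _), Finset.card_univ]

open Classical in
theorem card_superset_slacks_eq_one [Fintype T] [Nonempty T] (hI : 2 ≤ Fintype.card I)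
    (hρ : ∀ i, Function.Injective (ρ i))
    (hslack : ∀ i x, x ≠ Sum.inr i → ρ i (Sum.inr i) < ρ i x)
    (hslack' : ∀ i j t, j ≠ i → ρ i (Sum.inl t) < ρ i (Sum.inr j)) (i₀ : I) :
    (Finset.univ.filter fun R : Finset (T ⊕ I) =>
      (Dominant ρ R ∧ R.card = Fintype.card I) ∧
        (Finset.univ.erase i₀).image Sum.inr ⊆ R).card = 1 := by
  have hcard := card_slacks (T := T) i₀
  have hmem : ∀ i, i ≠ i₀ → Sum.inr i ∈ (Finset.univ.erase i₀).image (Sum.inr : I → T ⊕ I) :=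
    fun i hi => Finset.mem_image_of_mem _ (by simpa using hi)
  have hmem' : ∀ x, x ∈ (Finset.univ.erase i₀).image (Sum.inr : I → T ⊕ I) →
      ∃ i, i ≠ i₀ ∧ x = Sum.inr i := fun x hx => by
    obtain ⟨i, hi, rfl⟩ := Finset.mem_image.1 hx
    exact ⟨i, Finset.ne_of_mem_erase hi, rfl⟩
  obtain ⟨μ, a, b, hab, hμab, hμ, hμ', ha, hb, hdis, hiff⟩ :=
    (dominant_slacks hslack hslack' i₀).superset_iff hρ
      (Finset.card_pos.1 (by omega)) hcard
  have hμi : ∀ i, i ≠ i₀ → μ i = Sum.inr i := fun i hi => by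
    by_contra h
    exact absurd (hμ' i _ (hmem i hi)) (not_le.mpr (hslack i _ h))
  have hex : ∃ x, IsExtension ρ μ i₀ x :=
    exists_isExtension (t := Sum.inl (Classical.arbitrary T)) fun j hj => by
      rw [hμi j hj]
      exact hslack j _ (by simp)
  -- An extension at `b` would lie above the slack of `b` in ranking `i₀`, which only other slacks
  -- can do. Those are excluded because each is lowest in its own ranking.
  have hno : ∀ b, b ≠ i₀ → μ i₀ = μ b → ∀ x, ¬ IsExtension ρ μ b x := by
    intro b hb hμb x hx
    have h0 := hx.1 i₀ hb.symm
    rw [hμb, hμi b hb] at h0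
    rcases x with t | k
    · exact absurd h0 (hslack' i₀ b t hb).le.not_gt
    · by_cases hkb : k = b
      · exact absurd h0 (by rw [hkb]; exact lt_irrefl _)
      · by_cases hk : k = i₀
        · subst hk
          exact absurd h0 (hslack k _ (by simpa using hb)).le.not_gt
        · have := hx.1 k hkb
          rw [hμi k hk] at this
          exact lt_irrefl _ this
  have hor : ∀ x, (IsExtension ρ μ a x ∨ IsExtension ρ μ b x) ↔ IsExtension ρ μ i₀ x := by
    intro x
    by_cases h1 : a = i₀
    · subst h1
      exact or_iff_left (hno b hab.symm hμab x)
    · by_cases h2 : b = i₀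
      · subst h2
        exact or_iff_right (hno a hab hμab.symm x)
      · rw [hμi a h1, hμi b h2] at hμab
        exact absurd (Sum.inr_injective hμab) hab
  obtain ⟨x, hx⟩ := hex
  rw [Finset.card_eq_one]
  refine ⟨insert x ((Finset.univ.erase i₀).image Sum.inr), ?_⟩
  ext R
  simp only [Finset.mem_filter, Finset.mem_univ, true_and, Finset.mem_singleton]
  have h := hiff R
  constructor
  · intro hR
    obtain ⟨z, hz, hz'⟩ := h.1 (by convert hR)
    rw [(((hor z).1 hz).unique hρ hx)] at hz'
    convert hz'
  · intro hR
    have := h.2 ⟨x, (hor x).2 hx, by convert hR⟩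
    convert this

open Classical in
/-- In a set that does not meet all colours, the number of facets whose colours are all but one
prescribed colour, each met once, is even. -/
theorem even_card_facets {X : Type*} [Fintype X] (c : X → I) (i₀ : I) {R : Finset X}
    (hR : R.card = Fintype.card I) (hcol : R.image c ≠ Finset.univ) :
    Even (Finset.univ.filter fun S : Finset X =>
      (S.card + 1 = Fintype.card I ∧ S.image c = Finset.univ.erase i₀) ∧ S ⊆ R).card := by
  have hinj : ∀ S : Finset X, S.card + 1 = Fintype.card I → S.image c = Finset.univ.erase i₀ →
      Set.InjOn c S := fun S h1 h2 => by
    apply Finset.injOn_of_card_image_eq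
    rw [h2, Finset.card_erase_of_mem (Finset.mem_univ _), Finset.card_univ]
    omega
  rcases Finset.eq_empty_or_nonempty (Finset.univ.filter fun S : Finset X =>
      (S.card + 1 = Fintype.card I ∧ S.image c = Finset.univ.erase i₀) ∧ S ⊆ R) with h | ⟨S, hS⟩
  · rw [h]; simp
  simp only [Finset.mem_filter, Finset.mem_univ, true_and] at hS
  obtain ⟨⟨hSc, hSi⟩, hSR⟩ := hS
  obtain ⟨x, hx, rfl⟩ := Finset.exists_eq_insert_iff.2 ⟨hSR, hSc.trans hR.symm⟩
  have hcx : c x ≠ i₀ := fun h => hcol (by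
    rw [Finset.image_insert, hSi, h, Finset.insert_erase (Finset.mem_univ _)])
  obtain ⟨y, hy, hyx⟩ : ∃ y ∈ S, c y = c x := by
    rw [← Finset.mem_image, hSi]; simpa using hcx
  have hxy : y ≠ x := by rintro rfl; exact hx hy
  -- The points `x` and `y` share a colour, so an injectively coloured facet must omit one of them.
  suffices h : (Finset.univ.filter fun S' : Finset X =>
      (S'.card + 1 = Fintype.card I ∧ S'.image c = Finset.univ.erase i₀) ∧ S' ⊆ insert x S)
      = {S, (insert x S).erase y} by
    rw [h, Finset.card_pair]
    · exact even_two
    · intro h'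
      rw [h'] at hy
      simp at hy
  ext S'
  simp only [Finset.mem_filter, Finset.mem_univ, true_and, Finset.mem_insert,
    Finset.mem_singleton]
  constructor
  · rintro ⟨⟨h1, h2⟩, h3⟩
    obtain ⟨z, hz, hz'⟩ := Finset.exists_eq_insert_iff.2 ⟨h3, h1.trans hR.symm⟩
    have hS' : S' = (insert x S).erase z := by rw [← hz', Finset.erase_insert hz]
    by_cases hzx : z = x
    · left; rw [hS', hzx, Finset.erase_insert hx]
    · by_cases hzy : z = y
      · right; rw [hS', hzy]
      · refine absurd (hinj S' h1 h2 ?_ ?_ hyx) hxy <;> rw [hS'] <;> simp [hy, Ne.symm hzx, Ne.symm hzy]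
  · rintro (rfl | rfl)
    · exact ⟨⟨hSc, hSi⟩, hSR⟩
    · refine ⟨⟨?_, ?_⟩, Finset.erase_subset _ _⟩
      · rw [Finset.card_erase_add_one (by simp [hy]), hR]
      · rw [← hSi]
        ext i
        simp only [Finset.mem_image, Finset.mem_erase, Finset.mem_insert]
        constructor
        · rintro ⟨z, ⟨hz, rfl | hz'⟩, rfl⟩
          · exact ⟨y, hy, hyx⟩
          · exact ⟨z, hz', rfl⟩
        · rintro ⟨z, hz, rfl⟩
          by_cases hzy : z = y
          · exact ⟨x, ⟨hxy.symm, Or.inl rfl⟩, by rw [hzy, hyx]⟩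
          · exact ⟨z, ⟨hzy, Or.inr hz⟩, rfl⟩

-- Double counting of doors (facets with all colours but `i₀`) in rooms (dominant sets of full
-- size). If no room has all colours, each has an even number of doors. But every door lies in two
-- rooms, except the one made of all slacks other than that of `i₀`, which lies in one.
open Classical in
theorem exists_dominant_image_eq_univ [Fintype T] [Nonempty T] (hI : 2 ≤ Fintype.card I)
    (hρ : ∀ i, Function.Injective (ρ i))
    (hslack : ∀ i x, x ≠ Sum.inr i → ρ i (Sum.inr i) < ρ i x)
    (hslack' : ∀ i j t, j ≠ i → ρ i (Sum.inl t) < ρ i (Sum.inr j))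
    (c : T ⊕ I → I) (hc : ∀ i, c (Sum.inr i) = i) :
    ∃ R : Finset (T ⊕ I), Dominant ρ R ∧ R.image c = Finset.univ := by
  by_contra! hcon
  obtain ⟨i₀⟩ : Nonempty I := Fintype.card_pos_iff.1 (by omega)
  set rooms := Finset.univ.filter fun R : Finset (T ⊕ I) => Dominant ρ R ∧ R.card = Fintype.card I
    with hrooms
  set doors := Finset.univ.filter fun S : Finset (T ⊕ I) =>
    Dominant ρ S ∧ S.card + 1 = Fintype.card I ∧ S.image c = Finset.univ.erase i₀ with hdoors
  have hdc := Finset.sum_card_bipartiteAbove_eq_sum_card_bipartiteBelow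
    (s := doors) (t := rooms) (· ⊆ ·)
  have heven : Even (∑ R ∈ rooms, (doors.bipartiteBelow (· ⊆ ·) R).card) := by
    refine Finset.even_sum _ fun R hR => ?_
    obtain ⟨hR, hRc⟩ := (Finset.mem_filter.1 hR).2
    refine Eq.subst (motive := fun s : Finset (Finset (T ⊕ I)) => Even s.card) ?_
      (even_card_facets c i₀ hRc (hcon R hR))
    ext S
    simp only [Finset.bipartiteBelow, hdoors, Finset.mem_filter, Finset.mem_univ, true_and]
    exact ⟨fun h => ⟨⟨hR.mono h.2, h.1⟩, h.2⟩, fun h => ⟨h.1.2, h.2⟩⟩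
  rw [← hdc, ← Nat.not_odd_iff_even, Finset.odd_sum_iff_odd_card_odd] at heven
  apply heven
  suffices h : (doors.filter fun S => Odd (rooms.bipartiteAbove (· ⊆ ·) S).card)
      = {(Finset.univ.erase i₀).image Sum.inr} by
    rw [h]; simp
  ext S
  simp only [Finset.mem_filter, Finset.mem_singleton]
  constructor
  · rintro ⟨hS, hodd⟩
    obtain ⟨hS, hSc, hSi⟩ := (Finset.mem_filter.1 hS).2
    have hinl : ∀ t, Sum.inl t ∉ S := fun t ht => by
      rw [Finset.bipartiteAbove, hrooms, Finset.filter_filter] at hodd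
      have h2 := hS.card_superset_eq_two hρ hslack' hSc ht
      rw [h2] at hodd
      exact absurd hodd (by decide)
    ext x
    simp only [Finset.mem_image, Finset.mem_erase, Finset.mem_univ, and_true]
    constructor
    · intro hx
      rcases x with t | i
      · exact absurd hx (hinl t)
      · have : c (Sum.inr i) ∈ S.image c := Finset.mem_image_of_mem c hx
        rw [hSi, hc] at this
        exact ⟨i, Finset.ne_of_mem_erase this, rfl⟩
    · rintro ⟨i, hi, rfl⟩
      have : i ∈ S.image c := by rw [hSi]; simpa using hi
      obtain ⟨x, hx, hxi⟩ := Finset.mem_image.1 this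
      rcases x with t | j
      · exact absurd hx (hinl t)
      · rw [hc] at hxi; rwa [← hxi]
  · intro h
    constructor
    · rw [hdoors, Finset.mem_filter, h]
      refine ⟨Finset.mem_univ _, ?_, card_slacks i₀, ?_⟩
      · convert dominant_slacks hslack hslack' i₀
      · rw [Finset.image_image]
        rw [show c ∘ Sum.inr = id from funext hc, Finset.image_id]
    · rw [Finset.bipartiteAbove, hrooms, Finset.filter_filter]
      have h1 := card_superset_slacks_eq_one hI hρ hslack hslack' i₀
      have h2 : S = (Finset.univ.erase i₀).image Sum.inr := by convert h
      rw [← h2] at h1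
      rw [h1]
      exact odd_one

end Slack

/-- A form of Scarf's lemma: finitely many points, ranked injectively in at least two ways and
coloured by the rankings, contain a nonempty set `D` whose colours include a set `C` of rankings
in one of which any given point is at most as high as all of `D`. -/
theorem exists_colourful {T I : Type*} [Fintype T] [Fintype I] [Nonempty T]
    (hI : 2 ≤ Fintype.card I) (ρ : I → T → ℕ) (hρ : ∀ i, Function.Injective (ρ i)) (c : T → I) :
    ∃ (D : Finset T) (C : Finset I), D.Nonempty ∧
      (∀ t, ∃ i ∈ C, ∀ d ∈ D, ρ i t ≤ ρ i d) ∧ ∀ i ∈ C, ∃ d ∈ D, c d = i := by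
  classical
  obtain ⟨B, hB⟩ : ∃ B, ∀ p : I × T, ρ p.1 p.2 < B := by
    obtain ⟨B, hB⟩ := (Set.finite_range fun p : I × T => ρ p.1 p.2).bddAbove
    exact ⟨B + 1, fun p => Nat.lt_succ_of_le (hB ⟨p, rfl⟩)⟩
  let e := Fintype.equivFin I
  -- The shift by `1` leaves `0` for a ranking's own slack. The other slacks lie above all points,
  -- kept distinct by `e`.
  let σ : I → T ⊕ I → ℕ := fun i =>
    Sum.elim (fun t => ρ i t + 1) (fun j => if j = i then 0 else B + 1 + e j)
  have hσ : ∀ i, Function.Injective (σ i) := by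
    rintro i (s | j) (t | k) h
    · simp only [σ, Sum.elim_inl, add_left_inj] at h
      rw [hρ i h]
    · have := hB (i, s)
      simp only [σ, Sum.elim_inl, Sum.elim_inr] at h this
      split_ifs at h
      all_goals omega
    · have := hB (i, t)
      simp only [σ, Sum.elim_inl, Sum.elim_inr] at h this
      split_ifs at h
      all_goals omega
    · simp only [σ, Sum.elim_inr] at h
      split_ifs at h with h1 h2 h2
      · rw [h1, h2]
      · omega
      · omega
      · exact congrArg _ (e.injective (Fin.ext (by omega)))
  have hs1 : ∀ i x, x ≠ Sum.inr i → σ i (Sum.inr i) < σ i x := by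
    rintro i (t | j) h
    · simp [σ]
    · have : j ≠ i := fun h' => h (by rw [h'])
      simp only [σ, Sum.elim_inr, if_true, if_neg this]; omega
  have hs2 : ∀ i j t, j ≠ i → σ i (Sum.inl t) < σ i (Sum.inr j) := by
    intro i j t h
    have := hB (i, t)
    simp only [σ, Sum.elim_inl, Sum.elim_inr, if_neg h] at this ⊢; omega
  obtain ⟨R, hR, hRc⟩ := exists_dominant_image_eq_univ hI hσ hs1 hs2 (Sum.elim c id) fun i => rfl
  have hdom : ∀ t, ∃ i, Sum.inr i ∉ R ∧ ∀ d, Sum.inl d ∈ R → ρ i t ≤ ρ i d := by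
    intro t
    obtain ⟨i, hi⟩ := hR (Sum.inl t)
    refine ⟨i, fun h => absurd (hi _ h) (not_le.mpr (hs1 i _ (by simp))), fun d hd => ?_⟩
    have := hi _ hd
    simpa [σ] using this
  have hcol : ∀ i, Sum.inr i ∉ R → ∃ d, Sum.inl d ∈ R ∧ c d = i := by
    intro i hi
    have : i ∈ R.image (Sum.elim c id) := by rw [hRc]; simp
    obtain ⟨x, hx, hxi⟩ := Finset.mem_image.1 this
    rcases x with d | j
    · exact ⟨d, hx, hxi⟩
    · simp only [Sum.elim_inr, id] at hxi
      exact absurd (hxi ▸ hx) hi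
  -- A ranking whose slack lies in `R` cannot witness dominance over a point of `T`. One whose slack
  -- is missing must get its colour from a point of `T`.
  refine ⟨Finset.univ.filter fun d => Sum.inl d ∈ R, Finset.univ.filter fun i => Sum.inr i ∉ R,
    ?_, ?_, ?_⟩
  · obtain ⟨i, hi, -⟩ := hdom (Classical.arbitrary T)
    obtain ⟨d, hd, -⟩ := hcol i hi
    exact ⟨d, by simpa using hd⟩
  · simpa using hdom
  · simpa using hcol

/-! ### Brouwer's theorem on the simplex -/

/-- Approximate fixed points on a grid of mesh `1 / N`: near some point of the simplex, every
coordinate is almost increased by `f` somewhere. -/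
theorem exists_approx_fixedPoint {ι : Type*} [Fintype ι] (hι : 2 ≤ Fintype.card ι)
    {f : (ι → ℝ) → ι → ℝ} (hmaps : Set.MapsTo f (stdSimplex ℝ ι) (stdSimplex ℝ ι))
    {N : ℕ} (hN : 0 < N) :
    ∃ x ∈ stdSimplex ℝ ι, ∀ i, ∃ y ∈ stdSimplex ℝ ι,
      (∀ j, |y j - x j| ≤ Fintype.card ι / N) ∧ y i ≤ f y i + Fintype.card ι / N := by
  classical
  have hN' : (0 : ℝ) < N := by exact_mod_cast hN
  obtain ⟨i₀⟩ : Nonempty ι := Fintype.card_pos_iff.1 (by omega)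
  let T := {t : ι → ℕ // t ∈ Finset.univ.piAntidiag N}
  have _ : Fintype T := inferInstanceAs (Fintype {t // t ∈ Finset.univ.piAntidiag N})
  have hmem : ∀ t : ι → ℕ, t ∈ Finset.univ.piAntidiag N ↔ ∑ i, t i = N := by
    simp [Finset.mem_piAntidiag]
  have hT : Nonempty T := ⟨⟨Pi.single i₀ N, by simp [hmem]⟩⟩
  let p : T → ι → ℝ := fun t i => t.1 i / N
  have hp : ∀ t, p t ∈ stdSimplex ℝ ι := fun t =>
    ⟨fun i => by positivity, by
      have h : (∑ i, (t.1 i : ℝ)) = N := by exact_mod_cast (hmem _).1 t.2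
      simp only [p, ← Finset.sum_div, h, div_self hN'.ne']⟩
  -- Both points have coordinate sum `1`, so `f` cannot decrease every coordinate. The colour is one
  -- that it does not decrease.
  have hcol : ∀ t, ∃ i, p t i ≤ f (p t) i := fun t => by
    by_contra! h
    have := Finset.sum_lt_sum_of_nonempty ⟨i₀, Finset.mem_univ _⟩ fun i _ => h i
    rw [(hp t).2, (hmaps (hp t)).2] at this
    exact lt_irrefl _ this
  choose c hc using hcol
  let e := Fintype.equivFin T
  -- Rank by the `i`-th coordinate, breaking ties by the enumeration `e`.
  let ρ : ι → T → ℕ := fun i t => e t + Fintype.card T * t.1 i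
  have hρ : ∀ i, Function.Injective (ρ i) := fun i s t h => by
    have := congrArg (· % Fintype.card T) h
    simp only [ρ, Nat.add_mul_mod_self_left, Nat.mod_eq_of_lt (e _).2] at this
    exact e.injective (Fin.ext this)
  have hρ' : ∀ i s t, ρ i s ≤ ρ i t → s.1 i ≤ t.1 i := fun i s t h => by
    have := Nat.div_le_div_right (c := Fintype.card T) h
    simpa only [ρ, Nat.add_mul_div_left _ _ (Fintype.card_pos (α := T)),
      Nat.div_eq_of_lt (e _).2, zero_add] using this
  obtain ⟨D, C, hD, hdom, hDC⟩ := exists_colourful hι ρ hρ c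
  choose d hd hdmin using fun i : ι => D.exists_min_image (fun t => t.1 i) hD
  -- Otherwise some grid point exceeds the minimum over `D` in every coordinate of `C`,
  -- contradicting dominance. The leftover mass is placed at `i₀`.
  have hsum : N < ∑ i ∈ C, ((d i).1 i + 1) := by
    by_contra! h
    let u : ι → ℕ := fun i => if i ∈ C then (d i).1 i + 1 else 0
    have hu : ∑ i, u i ≤ N := by
      simpa only [u, Finset.sum_ite_mem, Finset.univ_inter] using h
    obtain ⟨i, hi, hit⟩ := hdom ⟨u + Pi.single i₀ (N - ∑ i, u i), (hmem _).2 (by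
      rw [Finset.sum_congr rfl fun i _ => Pi.add_apply u _ i, Finset.sum_add_distrib,
        Finset.sum_pi_single', if_pos (Finset.mem_univ _)]
      omega)⟩
    have h1 := hρ' _ _ _ (hit (d i) (hd i))
    simp only [Pi.add_apply, u, if_pos hi] at h1
    omega
  -- Every point of `D` dominates `w` coordinatewise, and its total `N` exceeds that of `w` by less
  -- than `card C`. So no single coordinate exceeds `w` by more than `card ι`.
  have hclose : ∀ t ∈ D, ∀ i, (i ∈ C → t.1 i ≤ (d i).1 i + Fintype.card ι) ∧
      (i ∉ C → t.1 i ≤ Fintype.card ι) := by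
    intro t ht i
    let w : ι → ℕ := fun j => if j ∈ C then (d j).1 j else 0
    have hw : ∑ j, w j = ∑ j ∈ C, (d j).1 j := by
      simp only [w, Finset.sum_ite_mem, Finset.univ_inter]
    have hle : ∀ j, w j ≤ t.1 j := fun j => by
      simp only [w]; split_ifs
      · exact hdmin j t ht
      · exact Nat.zero_le _
    rw [Finset.sum_add_distrib, Finset.sum_const, smul_eq_mul, mul_one, ← hw] at hsum
    have hCc := Finset.card_le_univ C
    have ht' := (hmem _).1 t.2
    have h1 := Finset.add_sum_erase Finset.univ w (Finset.mem_univ i)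
    have h2 := Finset.add_sum_erase Finset.univ t.1 (Finset.mem_univ i)
    have h3 : ∑ j ∈ Finset.univ.erase i, w j ≤ ∑ j ∈ Finset.univ.erase i, t.1 j :=
      Finset.sum_le_sum fun j _ => hle j
    have h4 : t.1 i ≤ w i + Fintype.card ι := by omega
    simp only [w] at h4
    exact ⟨fun hi => by rwa [if_pos hi] at h4, fun hi => by rwa [if_neg hi, zero_add] at h4⟩
  obtain ⟨t, ht⟩ := hD
  refine ⟨p t, hp t, fun i => ?_⟩
  -- For `i ∈ C` take a point of `D` coloured `i`. For `i ∉ C` the coordinate is itself at most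
  -- `card ι / N`, and `f` is nonnegative.
  by_cases hi : i ∈ C
  · obtain ⟨s, hs, rfl⟩ := hDC i hi
    refine ⟨p s, hp s, fun j => ?_, (hc s).trans (by simp; positivity)⟩
    have key : ∀ s ∈ D, ∀ t ∈ D, s.1 j ≤ t.1 j + Fintype.card ι := fun s hs t ht => by
      by_cases hj : j ∈ C
      · have h1 := (hclose s hs j).1 hj
        have h2 := hdmin j t ht
        omega
      · have h1 := (hclose s hs j).2 hj
        omega
    have h1 : (s.1 j : ℝ) ≤ t.1 j + Fintype.card ι := by exact_mod_cast key s hs t ht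
    have h2 : (t.1 j : ℝ) ≤ s.1 j + Fintype.card ι := by exact_mod_cast key t ht s hs
    rw [← sub_div, abs_div, abs_of_pos hN', div_le_div_iff_of_pos_right hN', abs_le]
    constructor <;> linarith
  · refine ⟨p t, hp t, fun j => by simp; positivity, ?_⟩
    have h1 : (t.1 i : ℝ) ≤ Fintype.card ι := by exact_mod_cast (hclose t ht i).2 hi
    have h2 : p t i ≤ Fintype.card ι / N := div_le_div_of_nonneg_right h1 hN'.le
    have h3 := (hmaps (hp t)).1 i
    linarith

/-- Brouwer's fixed point theorem for the standard simplex. -/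
theorem exists_fixedPoint_stdSimplex {ι : Type*} [Fintype ι] {f : (ι → ℝ) → ι → ℝ}
    (hf : ContinuousOn f (stdSimplex ℝ ι)) (hmaps : Set.MapsTo f (stdSimplex ℝ ι) (stdSimplex ℝ ι))
    (hne : (stdSimplex ℝ ι).Nonempty) : ∃ x ∈ stdSimplex ℝ ι, f x = x := by
  by_cases hι : Fintype.card ι ≤ 1
  · obtain ⟨x, hx⟩ := hne
    have := Fintype.card_le_one_iff_subsingleton.1 hι
    refine ⟨x, hx, funext fun i => ?_⟩
    have h1 := hx.2
    have h2 := (hmaps hx).2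
    rw [Fintype.sum_subsingleton _ i] at h1 h2
    rw [h1, h2]
  push Not at hι
  choose x hx y hy hyx hyf using fun N : ℕ =>
    exists_approx_fixedPoint hι hmaps (Nat.succ_pos N)
  obtain ⟨z, hz, φ, hφ, hxz⟩ := (isCompact_stdSimplex ℝ ι).tendsto_subseq hx
  have hmesh : Filter.Tendsto (fun N => (Fintype.card ι : ℝ) / ((φ N).succ : ℕ))
      Filter.atTop (nhds 0) :=
    (((tendsto_const_div_atTop_nhds_zero_nat _).comp (Filter.tendsto_add_atTop_nat 1)).comp
      hφ.tendsto_atTop)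
  have hle : ∀ i, z i ≤ f z i := by
    intro i
    have hyz : Filter.Tendsto (fun N => y (φ N) i) Filter.atTop (nhds z) := by
      rw [tendsto_pi_nhds] at hxz ⊢
      intro j
      have h0 : Filter.Tendsto (fun N => y (φ N) i j - x (φ N) j) Filter.atTop (nhds 0) :=
        squeeze_zero_norm (fun N => hyx (φ N) i j) hmesh
      simpa using h0.add (hxz j)
    have hfz : Filter.Tendsto (fun N => f (y (φ N) i)) Filter.atTop (nhds (f z)) :=
      (hf z hz).tendsto.comp
        (tendsto_nhdsWithin_iff.2 ⟨hyz, Filter.Eventually.of_forall fun N => hy (φ N) i⟩)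
    have h1 := (tendsto_pi_nhds.1 hyz) i
    have h2 := ((tendsto_pi_nhds.1 hfz) i).add hmesh
    rw [add_zero] at h2
    exact le_of_tendsto_of_tendsto' h1 h2 fun N => hyf (φ N) i
  refine ⟨z, hz, funext fun i => ?_⟩
  -- Coordinatewise inequality with equal sums forces equality.
  have := (Finset.sum_eq_sum_iff_of_le fun i _ => hle i).1 (hz.2.trans (hmaps hz).2.symm)
  exact (this i (Finset.mem_univ i)).symm

/-! ### Tensor evaluation as a homogeneous polynomial map -/

theorem applyVec_apply {n : ℕ} : ∀ {m : ℕ} (T : Tensor (m + 1) n) (x : Fin n → ℝ) (i : Fin n),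
    applyVec T x i = ∑ j : Fin m → Fin n, T (Fin.cons i j) * ∏ a, x (j a)
  | 0, T, x, i => by
    rw [Fintype.sum_unique]
    simp only [applyVec, Finset.univ_eq_empty, Finset.prod_empty, mul_one]
    congr 1
  | m + 1, T, x, i => by
    rw [applyVec, applyVec_apply, ← (Fin.snocEquiv fun _ : Fin (m + 1) => Fin n).sum_comp,
      Fintype.sum_prod_type_right]
    refine Finset.sum_congr rfl fun j _ => ?_
    rw [modeProd, Finset.sum_mul]
    refine Finset.sum_congr rfl fun l _ => ?_
    rw [Fin.prod_univ_castSucc]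
    have h : Fin.cons i ((Fin.snocEquiv fun _ : Fin (m + 1) => Fin n) (l, j))
        = (Fin.snoc (Fin.cons i j : Fin (m + 1) → Fin n) l : Fin (m + 2) → Fin n) :=
      Fin.cons_snoc_eq_snoc_cons i j l
    rw [h]
    simp only [Fin.snocEquiv_apply, Fin.snoc_castSucc, Fin.snoc_last, Fin.insertNth_last']
    ring

theorem outerPow_one {n : ℕ} : ∀ m : ℕ, outerPow (1 : Fin n → ℝ) m = 1
  | 0 => rfl
  | m + 1 => by
    funext i
    simp [outerPow, outer, outerPow_one m, ofVec]

theorem laplacian_cons {m n : ℕ} (α : ℝ) (P : Tensor (m + 2) n) (i : Fin n)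
    (j : Fin (m + 1) → Fin n) :
    laplacian α P (Fin.cons i j) = (if i = j 0 then 1 else 0) - α * P (Fin.cons i j) := by
  have h0 : Fin.cast (Nat.add_comm 2 m) (Fin.castAdd m (0 : Fin 2)) = 0 := rfl
  have h1 : Fin.cast (Nat.add_comm 2 m) (Fin.castAdd m (1 : Fin 2)) = Fin.succ 0 := rfl
  simp only [laplacian, castOrder, outer, outerPow_one, ofMatrix, Matrix.one_apply, Pi.sub_apply,
    Pi.smul_apply, smul_eq_mul, h0, h1, Fin.cons_zero, Fin.cons_succ, Pi.one_apply, mul_one]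

/-- The identity factor fixes the second index to `i`. The `m` remaining indices are free and
contribute `(∑ x)^m`. -/
theorem applyVec_laplacian {m n : ℕ} (α : ℝ) (P : Tensor (m + 2) n) (x : Fin n → ℝ) (i : Fin n) :
    applyVec (laplacian α P) x i = x i * (∑ j, x j) ^ m - α * applyVec P x i := by
  simp only [applyVec_apply, laplacian_cons, sub_mul, Finset.sum_sub_distrib, Finset.mul_sum,
    mul_assoc]
  congr 1
  rw [← (Fin.consEquiv fun _ : Fin (m + 1) => Fin n).sum_comp, Fintype.sum_prod_type,
    Fintype.sum_eq_single i, Fintype.sum_pow, Finset.mul_sum]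
  · refine Finset.sum_congr rfl fun j _ => ?_
    rw [Fin.prod_univ_succ]
    simp [Fin.consEquiv]
  · intro k hk
    refine Finset.sum_eq_zero fun j _ => ?_
    simp [Fin.consEquiv, Ne.symm hk]

theorem applyVec_nonneg {m n : ℕ} {P : Tensor (m + 1) n} (hP : 0 ≤ P) {x : Fin n → ℝ}
    (hx : 0 ≤ x) : 0 ≤ applyVec P x := fun i => by
  rw [applyVec_apply]
  exact Finset.sum_nonneg fun j _ => mul_nonneg (hP _) (Finset.prod_nonneg fun a _ => hx _)

theorem sum_applyVec_le {m n : ℕ} {P : Tensor (m + 1) n} (hP : IsColumnwiseSubstochastic P)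
    {x : Fin n → ℝ} (hx : x ∈ stdSimplex ℝ (Fin n)) : ∑ i, applyVec P x i ≤ 1 := by
  simp only [applyVec_apply]
  rw [Finset.sum_comm]
  calc ∑ j : Fin m → Fin n, ∑ i, P (Fin.cons i j) * ∏ a, x (j a)
      ≤ ∑ j : Fin m → Fin n, ∏ a, x (j a) := by
        refine Finset.sum_le_sum fun j _ => ?_
        rw [← Finset.sum_mul]
        refine mul_le_of_le_one_left (Finset.prod_nonneg fun a _ => hx.1 _) ?_
        have := hP.2 j
        simpa [Matrix.vecMul, dotProduct, unfold] using this
    _ = 1 := by rw [← Fintype.sum_pow, hx.2, one_pow]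

theorem continuous_applyVec {m n : ℕ} (P : Tensor (m + 1) n) : Continuous (applyVec P) := by
  refine continuous_pi fun i => ?_
  simp only [applyVec_apply]
  fun_prop

theorem applyVec_smul {m n : ℕ} (P : Tensor (m + 1) n) (s : ℝ) (x : Fin n → ℝ) :
    applyVec P (s • x) = s ^ m • applyVec P x := by
  funext i
  simp only [applyVec_apply, Pi.smul_apply, smul_eq_mul, Finset.prod_mul_distrib,
    Finset.prod_const, Finset.card_univ, Fintype.card_fin, Finset.mul_sum]
  exact Finset.sum_congr rfl fun j _ => by ring

end MLPPR

/-! ### Solving the MLPPR system -/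

/-- Here `k = m + 2` is the order of the tensor (so `k ≥ 2` is arbitrary). -/
theorem theorem3p6 (m n : ℕ) (P : MLPPR.Tensor (m + 2) n)
    (hP : MLPPR.IsColumnwiseSubstochastic P)
    (v : Fin n → ℝ) (hv : v ∈ stdSimplex ℝ (Fin n))
    (α : ℝ) (hα0 : 0 ≤ α) (hα1 : α < 1) :
    ∃ y : Fin n → ℝ, 0 ≤ y ∧ y ≠ 0 ∧ MLPPR.applyVec (MLPPR.laplacian α P) y = v := by
  have hlt : ∀ x ∈ stdSimplex ℝ (Fin n), 0 < 1 - α * ∑ i, MLPPR.applyVec P x i := fun x hx => by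
    have := mul_le_mul_of_nonneg_left (MLPPR.sum_applyVec_le hP hx) hα0
    linarith
  obtain ⟨x, hx, hfx⟩ := MLPPR.exists_fixedPoint_stdSimplex
    (f := fun x => α • MLPPR.applyVec P x + (1 - α * ∑ i, MLPPR.applyVec P x i) • v)
    (by
      have := MLPPR.continuous_applyVec P
      exact Continuous.continuousOn (by fun_prop))
    (fun x hx => ⟨fun i => add_nonneg (mul_nonneg hα0 (MLPPR.applyVec_nonneg hP.1 hx.1 i))
        (mul_nonneg (hlt x hx).le (hv.1 i)), by
      simp only [Pi.add_apply, Pi.smul_apply, smul_eq_mul, Finset.sum_add_distrib,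
        ← Finset.mul_sum, hv.2]
      ring⟩) ⟨v, hv⟩
  set σ := 1 - α * ∑ i, MLPPR.applyVec P x i
  have hσ : 0 < σ := hlt x hx
  -- Scaling by `s` multiplies the Laplacian side by `s ^ (m + 1)`, which has to cancel `σ`.
  obtain ⟨s, hs, hsσ⟩ : ∃ s : ℝ, 0 < s ∧ s ^ (m + 1) = σ⁻¹ :=
    ⟨σ⁻¹ ^ (((m + 1 : ℕ) : ℝ)⁻¹), by positivity,
      Real.rpow_inv_natCast_pow (by positivity) (Nat.succ_ne_zero m)⟩
  refine ⟨s • x, fun i => mul_nonneg hs.le (hx.1 i), fun h => ?_, ?_⟩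
  · have h0 : x = 0 := (smul_eq_zero.1 h).resolve_left hs.ne'
    have := hx.2
    simp [h0] at this
  · funext i
    have hi := congrFun hfx i
    simp only [Pi.add_apply, Pi.smul_apply, smul_eq_mul] at hi
    rw [MLPPR.applyVec_laplacian, MLPPR.applyVec_smul, hsσ]
    simp only [Pi.smul_apply, smul_eq_mul, ← Finset.mul_sum, hx.2, mul_one]
    calc s * x i * s ^ m - α * (σ⁻¹ * MLPPR.applyVec P x i)
        = s ^ (m + 1) * x i - σ⁻¹ * (α * MLPPR.applyVec P x i) := by ring
      _ = σ⁻¹ * (σ * v i) := by rw [hsσ, ← mul_sub]; congr 1; linarith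
      _ = v i := inv_mul_cancel_left₀ hσ.ne' _
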